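/- There are universal constants $c,C>0$ such that the following holds for every non-increasing sequence $p=(p(j))_{j\ge 1}$ with values in $[0,\tfrac12]$. For a probability distribution $\mu$ on $\{0,1\}^{\mathbb N}$ (with the product $\sigma$-algebra) with mean sequence $m_\mu(j)=\mathbb E_{X\sim\mu}[X(j)]$, and for $n\ge 1$, let $$\Delta_n(\mu)=\mathbb E\,\sup_{j\ge1}\Big|\frac1n\sum_{i=1}^n X_i(j)-m_\mu(j)\Big|,\qquad X_1,\dots,X_n\ \text{i.i.d.}\sim\mu .$$ 1. There is a distribution $\mu$ on $\{0,1\}^{\mathbb N}$ with mean sequence $m_\mu=p$ such that for all $n\ge1$ $$c\,\min\Big(p(1),\sqrt{\tfrac{p(1)}{n}}\Big)\le\Delta_n(\mu)\le C\,\min\Big(p(1),\sqrt{\tfrac{p(1)}{n}}\Big);$$ in fact one may take for $\mu$ the law of $X=(\mathbf 1[U\le p(j)])_{j\ge1}$, where a single $U$, uniform on $[0,1]$, is used for all coordinates. 2. For every distribution $\nu$ on $\{0,1\}^{\mathbb N}$ with mean sequence $m_\nu=p$ and every $n\ge1$, $$\Delta_n(\nu)\ge c\,\min\Big(p(1),\sqrt{\tfrac{p(1)}{n}}\Big).$$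 Hence, up to universal constants, this is the best lower bound on $\Delta_n$ that depends only on the mean sequence $p$ and $n$. -/

import Mathlib

open MeasureTheory

/-- The numerical value (`0` or `1`) of a point of `{0,1}`, modelled by `Bool`. -/
def bitVal (b : Bool) : ℝ := if b then 1 else 0

/-- The mean `𝔼_{X ∼ μ}[X]`, a real sequence, of a distribution `μ` on `{0,1}^ℕ`
(with its product `σ`-algebra). The first coordinate, written `p(1)` in one-based indexing,
has index `0`. -/
noncomputable def meanSeq (μ : Measure (ℕ → Bool)) (j : ℕ) : ℝ :=
  ∫ x, bitVal (x j) ∂μ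

/-- The empirical mean `p̂_n = (1/n) ∑ᵢ Xᵢ` of `n` samples in `{0,1}^ℕ`. -/
noncomputable def empMean {n : ℕ} (X : Fin n → ℕ → Bool) (j : ℕ) : ℝ :=
  (∑ i, bitVal (X i j)) / n

/-- The maximal deviation `‖p̂_n - 𝔼_μ[X]‖_∞` of the empirical mean of `n` samples. -/
noncomputable def maxDev (μ : Measure (ℕ → Bool)) {n : ℕ} (X : Fin n → ℕ → Bool) : ℝ :=
  ⨆ j, |empMean X j - meanSeq μ j|

/-- `Δ_n(μ) = 𝔼 ‖p̂_n - 𝔼_μ[X]‖_∞`, where `p̂_n` is the empirical mean of `n` independent samples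
of `μ`, that is, of a sample from the product measure `μ^{⊗ n}`. -/
noncomputable def expMaxDev (μ : Measure (ℕ → Bool)) (n : ℕ) : ℝ :=
  ∫ X, maxDev μ X ∂(Measure.pi fun _ : Fin n => μ)

/-- The law on `{0,1}^ℕ` of `(1[U ≤ p(j)])_j`, with one `U` uniform on `[0,1]`
shared by all coordinates. -/
noncomputable def monotoneCoupling (p : ℕ → ℝ) : Measure (ℕ → Bool) :=
  (volume.restrict (Set.Icc (0 : ℝ) 1)).map fun u j => decide (u ≤ p j)

theorem bitVal_mem (b : Bool) : 0 ≤ bitVal b ∧ bitVal b ≤ 1 := by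
  cases b <;> simp [bitVal]

theorem measurable_bitVal : Measurable bitVal := measurable_of_countable _

theorem abs_empMean_sub_meanSeq_le (μ : Measure (ℕ → Bool)) [IsProbabilityMeasure μ] {n : ℕ}
    (X : Fin n → ℕ → Bool) (j : ℕ) : |empMean X j - meanSeq μ j| ≤ 1 := by
  have h1 : 0 ≤ meanSeq μ j := integral_nonneg fun x => (bitVal_mem (x j)).1
  have h2 : meanSeq μ j ≤ 1 := by
    have h := integral_mono_of_nonneg (μ := μ) (f := fun x => bitVal (x j)) (g := fun _ => (1 : ℝ))
      (Filter.Eventually.of_forall fun x => (bitVal_mem (x j)).1) (integrable_const 1)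
      (Filter.Eventually.of_forall fun x => (bitVal_mem (x j)).2)
    simpa [meanSeq] using h
  have h3 : 0 ≤ empMean X j :=
    div_nonneg (Finset.sum_nonneg fun i _ => (bitVal_mem (X i j)).1) (Nat.cast_nonneg n)
  have h4 : empMean X j ≤ 1 := by
    refine div_le_one_of_le₀ ?_ (Nat.cast_nonneg n)
    calc ∑ i, bitVal (X i j) ≤ ∑ _i : Fin n, (1 : ℝ) :=
          Finset.sum_le_sum fun i _ => (bitVal_mem (X i j)).2
      _ = n := by simp
  rw [abs_le]
  constructor <;> linarith

/-- The supremum in `maxDev` is a genuine one. -/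
theorem bddAbove_maxDev (μ : Measure (ℕ → Bool)) [IsProbabilityMeasure μ] {n : ℕ}
    (X : Fin n → ℕ → Bool) : BddAbove (Set.range fun j => |empMean X j - meanSeq μ j|) :=
  ⟨1, by rintro _ ⟨j, rfl⟩; exact abs_empMean_sub_meanSeq_le μ X j⟩

/-- The expectation in `expMaxDev` is a genuine one. -/
theorem integrable_maxDev (μ : Measure (ℕ → Bool)) [IsProbabilityMeasure μ] (n : ℕ) :
    Integrable (fun X : Fin n → ℕ → Bool => maxDev μ X) (Measure.pi fun _ : Fin n => μ) := by
  have hm : Measurable fun X : Fin n → ℕ → Bool => maxDev μ X := by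
    refine Measurable.iSup fun j => ?_
    have h : Measurable fun X : Fin n → ℕ → Bool => empMean X j := by
      refine Measurable.div_const (Finset.measurable_sum _ fun i _ => ?_) _
      exact measurable_bitVal.comp ((measurable_pi_apply j).comp (measurable_pi_apply i))
    exact (h.sub_const _).abs
  refine Integrable.of_bound hm.aestronglyMeasurable 1 (Filter.Eventually.of_forall fun X => ?_)
  rw [Real.norm_eq_abs, maxDev, abs_of_nonneg (Real.iSup_nonneg fun j => abs_nonneg _)]
  exact ciSup_le fun j => abs_empMean_sub_meanSeq_le μ X j

/-! Lower bound: the first coordinate suffices. With `a = n * p 0`, its centred sum S has variance w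
between a/2 and a because `p 0 ≤ 1/2`, and fourth moment at most 3w² + w (`moments_sum_eval`). A
variance carried with so small a fourth moment forces E|S| ≥ min(a, √a)/12
(`min_le_integral_abs_sum_eval`); division by n gives `le_expMaxDev`.

Upper bound: a shared uniform U makes the events U ≤ p j nested. Hence every deviation is at most
the empirical mean of the first coordinate plus `p 0`, which gives 2 `p 0` in expectation. For the
square root, (1[U ≤ t] - t)/(1 - t) is a martingale in t: it stays at 1 once U ≤ t, and before that
it is a function of t alone. Read in increasing order of thresholds, the sum over the samples is a
martingale ending at threshold `p 0`, so Doob's L² inequality bounds the whole supremum by the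
standard deviation at the end, of order √(n `p 0`), however many coordinates there are.

Doob's inequality is used in a pathwise form (`runMax_sq_le`), so no conditional expectation
appears: the martingale property enters only as the orthogonality `integral_runMax_mul_increment`.
-/

/-! ### Moments of sums of independent variables. -/

open ProbabilityTheory in
/-- Under a product measure, a function not depending on the coordinate `i` is uncorrelated with
every function of the coordinate `i`. -/
theorem integral_pi_mul_eval {α : Type*} [MeasurableSpace α] [Nonempty α] (ρ : Measure α)
    [IsProbabilityMeasure ρ] {n : ℕ} (i : Fin n) {G : (Fin n → α) → ℝ} (hG : Measurable G)
    (hGi : ∀ X a, G (Function.update X i a) = G X) {h : α → ℝ} (hh : Measurable h) :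
    ∫ X, G X * h (X i) ∂(Measure.pi fun _ : Fin n => ρ) =
      (∫ X, G X ∂(Measure.pi fun _ : Fin n => ρ)) * ∫ a, h a ∂ρ := by
  obtain ⟨a₀⟩ := ‹Nonempty α›
  have hind : iIndepFun (fun (j : Fin n) (X : Fin n → α) => X j)
      (Measure.pi fun _ : Fin n => ρ) :=
    iIndepFun_pi (X := fun _ => id) fun _ => aemeasurable_id
  have hpair := hind.indepFun_finset {i}ᶜ {i} disjoint_compl_left
    fun j => measurable_pi_apply j
  -- Filling coordinate `i` with the arbitrary value `a₀` exhibits `G` as a function of the other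
  -- coordinates only.
  let ext : ((({i}ᶜ : Finset (Fin n)) : Type) → α) → Fin n → α := fun Y j =>
    if hj : j ∈ ({i}ᶜ : Finset (Fin n)) then Y ⟨j, hj⟩ else a₀
  have hext : Measurable ext := by
    refine measurable_pi_lambda _ fun j => ?_
    by_cases hj : j ∈ ({i}ᶜ : Finset (Fin n))
    · simpa only [ext, hj, dite_true] using measurable_pi_apply _
    · simpa only [ext, hj, dite_false] using measurable_const
  have hres : ∀ X : Fin n → α, G (ext fun j => X j) = G X := by
    intro X
    rw [← hGi X a₀]
    congr 1
    funext j
    by_cases hj : j = i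
    · subst hj; simp [ext]
    · simp [ext, hj]
  have hcomp := hpair.comp (hG.comp hext) (hh.comp (measurable_pi_apply
    (⟨i, Finset.mem_singleton_self i⟩ : (({i} : Finset (Fin n)) : Type))))
  have hmul := hcomp.integral_fun_mul_eq_mul_integral
    ((hG.comp hext).comp (measurable_pi_lambda _ fun j =>
      measurable_pi_apply _)).aestronglyMeasurable
    (hh.comp (measurable_pi_apply i)).aestronglyMeasurable
  simp only [Function.comp_apply, hres] at hmul
  rw [hmul]
  congr 1
  exact integral_comp_eval (μ := fun _ : Fin n => ρ) (i := i) hh.aestronglyMeasurable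

/-- A measurable function bounded by a constant is integrable for a probability measure. -/
theorem integrable_of_abs_le {α : Type*} [MeasurableSpace α] {P : Measure α}
    [IsProbabilityMeasure P] {f : α → ℝ} (hf : Measurable f) {b : ℝ} (hb : ∀ x, |f x| ≤ b) :
    Integrable f P :=
  Integrable.of_bound hf.aestronglyMeasurable b (Filter.Eventually.of_forall hb)

theorem abs_sum_eval_le {α : Type*} {f : α → ℝ} (hb : ∀ x, |f x| ≤ 1) {n : ℕ}
    (s : Finset (Fin n)) (X : Fin n → α) : |∑ i ∈ s, f (X i)| ≤ s.card := by
  calc |∑ i ∈ s, f (X i)| ≤ ∑ i ∈ s, |f (X i)| := Finset.abs_sum_le_sum_abs _ _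
    _ ≤ ∑ _i ∈ s, (1 : ℝ) := Finset.sum_le_sum fun i _ => hb _
    _ = s.card := by simp

/-- Moments of order one, two and four of a sum of independent copies of a centred variable with
values in `[-1, 1]`. -/
theorem moments_sum_eval {α : Type*} [MeasurableSpace α] [Nonempty α] (ρ : Measure α)
    [IsProbabilityMeasure ρ] {f : α → ℝ} (hf : Measurable f) (hb : ∀ x, |f x| ≤ 1)
    (h0 : ∫ x, f x ∂ρ = 0) {n : ℕ} (s : Finset (Fin n)) :
    ∫ X, ∑ i ∈ s, f (X i) ∂(Measure.pi fun _ : Fin n => ρ) = 0 ∧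
    ∫ X, (∑ i ∈ s, f (X i)) ^ 2 ∂(Measure.pi fun _ : Fin n => ρ) =
      s.card * ∫ x, f x ^ 2 ∂ρ ∧
    ∫ X, (∑ i ∈ s, f (X i)) ^ 4 ∂(Measure.pi fun _ : Fin n => ρ) ≤
      3 * (s.card * ∫ x, f x ^ 2 ∂ρ) ^ 2 + s.card * ∫ x, f x ^ 2 ∂ρ := by
  induction s using Finset.induction_on with
  | empty => simp
  | insert a s ha ih =>
    obtain ⟨ih1, ih2, ih4⟩ := ih
    set P := Measure.pi fun _ : Fin n => ρ with hP
    set v := ∫ x, f x ^ 2 ∂ρ with hv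
    let S : (Fin n → α) → ℝ := fun X => ∑ i ∈ s, f (X i)
    have hSm : Measurable S :=
      Finset.measurable_sum _ fun i _ => hf.comp (measurable_pi_apply i)
    have hSi : ∀ X b, S (Function.update X a b) = S X := fun X b =>
      Finset.sum_congr rfl fun i hi => by
        rw [Function.update_of_ne (ne_of_mem_of_not_mem hi ha)]
    -- The sum over `s` is independent of the new summand, so mixed moments factor; those with a
    -- first power of either factor vanish.
    have key : ∀ k l : ℕ, ∫ X, S X ^ k * f (X a) ^ l ∂P = (∫ X, S X ^ k ∂P) * ∫ x, f x ^ l ∂ρ :=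
      fun k l => integral_pi_mul_eval ρ a (G := fun X => S X ^ k) (h := fun x => f x ^ l)
        (hSm.pow_const k) (fun X b => by simp only [hSi]) (hf.pow_const l)
    have hint : ∀ k l : ℕ, Integrable (fun X => S X ^ k * f (X a) ^ l) P := by
      intro k l
      refine integrable_of_abs_le (b := (s.card : ℝ) ^ k * 1 ^ l)
        ((hSm.pow_const k).mul ((hf.comp (measurable_pi_apply a)).pow_const l)) fun X => ?_
      rw [abs_mul, abs_pow, abs_pow]
      exact mul_le_mul (pow_le_pow_left₀ (abs_nonneg _) (abs_sum_eval_le hb s X) k)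
        (pow_le_pow_left₀ (abs_nonneg _) (hb _) l) (by positivity) (by positivity)
    have hf4 : ∫ x, f x ^ 4 ∂ρ ≤ v := by
      have hi : ∀ k : ℕ, Integrable (fun x => f x ^ k) ρ := fun k =>
        integrable_of_abs_le (b := 1) (hf.pow_const k) fun x => by
          rw [abs_pow]; exact pow_le_one₀ (abs_nonneg _) (hb x)
      refine integral_mono (hi 4) (hi 2) fun x => ?_
      have h1 : f x ^ 2 ≤ 1 := by rw [← sq_abs]; exact pow_le_one₀ (abs_nonneg _) (hb x)
      nlinarith [sq_nonneg (f x)]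
    have e10 := key 0 1
    have e01 := key 1 0
    have e11 := key 1 1
    have e02 := key 0 2
    have e20 := key 2 0
    have e13 := key 1 3
    have e22 := key 2 2
    have e31 := key 3 1
    have e04 := key 0 4
    have e40 := key 4 0
    have hP1 : ∫ _X, (1 : ℝ) ∂P = 1 := by simp
    have hρ1 : ∫ _x, (1 : ℝ) ∂ρ = 1 := by simp
    have i1 : ∫ X, S X ∂P = 0 := ih1
    have i2 : ∫ X, S X ^ 2 ∂P = s.card * v := ih2
    simp only [pow_one, h0, pow_zero, hP1, hρ1, i1, i2, ← hv, mul_zero, mul_one, zero_mul,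
      one_mul] at e10 e01 e11 e02 e20 e13 e22 e31 e04 e40
    simp only [Finset.sum_insert ha, Finset.card_insert_of_notMem ha, Nat.cast_add, Nat.cast_one]
    have j10 := hint 0 1
    have j01 := hint 1 0
    have j11 := hint 1 1
    have j02 := hint 0 2
    have j20 := hint 2 0
    have j13 := hint 1 3
    have j22 := hint 2 2
    have j31 := hint 3 1
    have j04 := hint 0 4
    have j40 := hint 4 0
    simp only [pow_one, pow_zero, mul_one, one_mul] at j10 j01 j11 j02 j20 j13 j22 j31 j04 j40
    refine ⟨?_, ?_, ?_⟩
    · rw [integral_add j10 j01, e10, i1, add_zero]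
    · have : ∀ X : Fin n → α, (f (X a) + ∑ i ∈ s, f (X i)) ^ 2 =
          f (X a) ^ 2 + 2 * (S X * f (X a)) + S X ^ 2 := fun X => by simp only [S]; ring
      simp only [this]
      rw [integral_add (j02.fun_add (j11.const_mul 2)) j20, integral_add j02 (j11.const_mul 2),
        integral_const_mul, e02, e11, i2]
      ring
    · have : ∀ X : Fin n → α, (f (X a) + ∑ i ∈ s, f (X i)) ^ 4 =
          f (X a) ^ 4 + 4 * (S X * f (X a) ^ 3) + 6 * (S X ^ 2 * f (X a) ^ 2)
            + 4 * (S X ^ 3 * f (X a)) + S X ^ 4 := fun X => by simp only [S]; ring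
      simp only [this]
      have k1 := j04.fun_add (j13.const_mul 4)
      have k2 := k1.fun_add (j22.const_mul 6)
      have k3 := k2.fun_add (j31.const_mul 4)
      rw [integral_add k3 j40, integral_add k2 (j31.const_mul 4), integral_add k1 (j22.const_mul 6),
        integral_add j04 (j13.const_mul 4)]
      simp only [integral_const_mul]
      rw [e13, e22, e31]
      have ih4' : ∫ X, S X ^ 4 ∂P ≤ 3 * (s.card * v) ^ 2 + s.card * v := ih4
      -- With m the cardinality of `s`, the new terms are 6mv² and at most v, while the target grows
      -- by 3(2m + 1)v² + v.
      nlinarith [sq_nonneg v]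

/-- A centred sum of `n` independent variables with values in `[-1, 1]` and total variance between
`a / 2` and `a` has absolute first moment of order at least `min a √a`. -/
theorem min_le_integral_abs_sum_eval {α : Type*} [MeasurableSpace α] [Nonempty α] (ρ : Measure α)
    [IsProbabilityMeasure ρ] {f : α → ℝ} (hf : Measurable f) (hb : ∀ x, |f x| ≤ 1)
    (h0 : ∫ x, f x ∂ρ = 0) (n : ℕ) {a : ℝ} (ha : 0 ≤ a)
    (hlow : a / 2 ≤ n * ∫ x, f x ^ 2 ∂ρ) (hup : n * ∫ x, f x ^ 2 ∂ρ ≤ a) :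
    1 / 12 * min a (Real.sqrt a) ≤
      ∫ X, |∑ i, f (X i)| ∂(Measure.pi fun _ : Fin n => ρ) := by
  obtain ⟨-, h2, h4⟩ := moments_sum_eval ρ hf hb h0 (Finset.univ : Finset (Fin n))
  rw [Finset.card_univ, Fintype.card_fin] at h2 h4
  set P := Measure.pi fun _ : Fin n => ρ
  set w := n * ∫ x, f x ^ 2 ∂ρ
  let S : (Fin n → α) → ℝ := fun X => ∑ i, f (X i)
  have hSm : Measurable S :=
    Finset.measurable_sum _ fun i _ => hf.comp (measurable_pi_apply i)
  have hSb : ∀ X, |S X| ≤ n := fun X => by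
    simpa using abs_sum_eval_le hb (Finset.univ : Finset (Fin n)) X
  have hint : ∀ k : ℕ, Integrable (fun X => S X ^ k) P := fun k =>
    integrable_of_abs_le (b := (n : ℝ) ^ k) (hSm.pow_const k) fun X => by
      rw [abs_pow]; exact pow_le_pow_left₀ (abs_nonneg _) (hSb X) k
  -- Truncation level: t² is twice 3a + 1 ≥ 3w + 1, so the fourth-moment term costs at most half of
  -- the second-moment term.
  set t := Real.sqrt (6 * a + 2)
  have ht2 : t ^ 2 = 6 * a + 2 := Real.sq_sqrt (by positivity)
  have ht : 0 < t := Real.sqrt_pos.2 (by positivity)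
  -- This is u² - u⁴ ≤ u for u ≥ 0, rescaled by u = |S|/t.
  have hpt : ∀ X, 1 / t * S X ^ 2 - 1 / t ^ 3 * S X ^ 4 ≤ |S X| := by
    intro X
    have hu : ∀ u : ℝ, 0 ≤ u → u ^ 2 - u ^ 4 ≤ u := by
      intro u hu
      rcases le_total u 1 with h | h
      · nlinarith [pow_nonneg hu 4]
      · nlinarith [pow_le_pow_right₀ h (show 2 ≤ 4 by norm_num)]
    have := mul_le_mul_of_nonneg_left (hu (|S X| / t) (by positivity)) ht.le
    rw [div_pow, div_pow, sq_abs, Even.pow_abs (by decide : Even 4)] at this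
    calc 1 / t * S X ^ 2 - 1 / t ^ 3 * S X ^ 4
        = t * (S X ^ 2 / t ^ 2 - S X ^ 4 / t ^ 4) := by field_simp
      _ ≤ t * (|S X| / t) := this
      _ = |S X| := by field_simp
  have hI : 1 / t * w - 1 / t ^ 3 * (3 * w ^ 2 + w) ≤ ∫ X, |S X| ∂P := by
    calc 1 / t * w - 1 / t ^ 3 * (3 * w ^ 2 + w)
        ≤ 1 / t * ∫ X, S X ^ 2 ∂P - 1 / t ^ 3 * ∫ X, S X ^ 4 ∂P := by
          rw [h2]; gcongr
      _ = ∫ X, (1 / t * S X ^ 2 - 1 / t ^ 3 * S X ^ 4) ∂P := by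
          rw [integral_sub ((hint 2).const_mul _) ((hint 4).const_mul _), integral_const_mul,
            integral_const_mul]
      _ ≤ ∫ X, |S X| ∂P := integral_mono (((hint 2).const_mul _).sub ((hint 4).const_mul _))
          (integrable_of_abs_le hSm.abs fun X => by rw [abs_abs]; exact hSb X) hpt
  have hw : a / (4 * t) ≤ 1 / t * w - 1 / t ^ 3 * (3 * w ^ 2 + w) := by
    have e : 1 / t * w - 1 / t ^ 3 * (3 * w ^ 2 + w) = w * (t ^ 2 - (3 * w + 1)) / t ^ 3 := by
      field_simp
    have e' : a / (4 * t) = a * t ^ 2 / 4 / t ^ 3 := by field_simp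
    rw [e, e', ht2]
    gcongr
    nlinarith
  refine le_trans ?_ (hw.trans hI)
  rw [le_div_iff₀ (by positivity)]
  rcases le_total a 1 with h | h
  · have : t ≤ 3 := by nlinarith
    have := min_le_left a (Real.sqrt a)
    have : 0 ≤ min a (Real.sqrt a) := by positivity
    nlinarith
  · have hs := Real.sq_sqrt ha
    have hs0 := Real.sqrt_nonneg a
    have : t ≤ 3 * Real.sqrt a := by nlinarith
    have := min_le_right a (Real.sqrt a)
    calc 1 / 12 * min a (Real.sqrt a) * (4 * t)
        ≤ 1 / 12 * Real.sqrt a * (4 * (3 * Real.sqrt a)) := by gcongr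
      _ = a := by nlinarith

/-! ### Running maxima and the pathwise Doob inequality. -/

/-- The maximum of `0, x 0, …, x k`. -/
noncomputable def runMax (x : ℕ → ℝ) : ℕ → ℝ
  | 0 => max 0 (x 0)
  | k + 1 => max (runMax x k) (x (k + 1))

theorem runMax_nonneg (x : ℕ → ℝ) (k : ℕ) : 0 ≤ runMax x k := by
  induction k with
  | zero => exact le_max_left _ _
  | succ k ih => exact ih.trans (le_max_left _ _)

theorem le_runMax (x : ℕ → ℝ) {j k : ℕ} (h : j ≤ k) : x j ≤ runMax x k := by
  induction k with
  | zero => obtain rfl := Nat.le_zero.1 h; exact le_max_right _ _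
  | succ k ih =>
    rcases Nat.le_succ_iff.1 h with h | rfl
    · exact (ih h).trans (le_max_left _ _)
    · exact le_max_right _ _

theorem runMax_congr {x y : ℕ → ℝ} {k : ℕ} (h : ∀ j ≤ k, x j = y j) :
    runMax x k = runMax y k := by
  induction k with
  | zero => simp only [runMax, h 0 le_rfl]
  | succ k ih =>
    simp only [runMax, h (k + 1) le_rfl, ih fun j hj => h j (Nat.le_succ_of_le hj)]

theorem runMax_le {x : ℕ → ℝ} {b : ℝ} (hb : 0 ≤ b) (h : ∀ j, x j ≤ b) (k : ℕ) :
    runMax x k ≤ b := by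
  induction k with
  | zero => exact max_le hb (h 0)
  | succ k ih => exact max_le ih (h _)

theorem measurable_runMax {α : Type*} [MeasurableSpace α] {x : ℕ → α → ℝ}
    (hx : ∀ k, Measurable (x k)) (k : ℕ) : Measurable fun a => runMax (fun j => x j a) k := by
  induction k with
  | zero => exact measurable_const.max (hx 0)
  | succ k ih => exact ih.max (hx _)

/-- The pathwise form of Doob's `L²` maximal inequality. -/
theorem runMax_sq_le (x : ℕ → ℝ) (n : ℕ) :
    runMax x n ^ 2 + 2 * ∑ k ∈ Finset.range n, runMax x k * (x (k + 1) - x k) ≤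
      2 * (x n * runMax x n) := by
  induction n with
  | zero =>
    simp only [runMax, Finset.range_zero, Finset.sum_empty]
    rcases max_cases 0 (x 0) with ⟨h, _⟩ | ⟨h, _⟩ <;> rw [h] <;> nlinarith [sq_nonneg (x 0)]
  | succ n ih =>
    rw [Finset.sum_range_succ]
    simp only [runMax]
    -- If the maximum does not move, both sides gain the same amount; at a new record the right side
    -- gains more by (`runMax x n` - `x (n + 1)`)².
    rcases max_cases (runMax x n) (x (n + 1)) with ⟨h, _⟩ | ⟨h, _⟩ <;> rw [h]
    · nlinarith
    · nlinarith [sq_nonneg (runMax x n - x (n + 1))]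

/-! ### The empirical process as a martingale in the threshold. -/

/-- The normalised indicator `(1[u ≤ t] - t) / (1 - t)`, a martingale in `t` when `u` is uniform
on `[0, 1]`. -/
noncomputable def stdInd (t u : ℝ) : ℝ := ((if u ≤ t then 1 else 0) - t) / (1 - t)

theorem measurable_ite_le (t : ℝ) : Measurable fun u : ℝ => if u ≤ t then (1 : ℝ) else 0 :=
  Measurable.ite measurableSet_Iic measurable_const measurable_const

theorem measurable_stdInd (t : ℝ) : Measurable (stdInd t) :=
  ((measurable_ite_le t).sub_const t).div_const _

theorem stdInd_of_le {t u : ℝ} (ht : t ≤ 1 / 2) (h : u ≤ t) : stdInd t u = 1 := by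
  rw [stdInd, if_pos h]
  exact div_self (by linarith)

theorem stdInd_of_lt {t u : ℝ} (h : t < u) : stdInd t u = -t / (1 - t) := by
  rw [stdInd, if_neg h.not_ge, zero_sub]

theorem abs_stdInd_le {t : ℝ} (ht : t ∈ Set.Icc (0 : ℝ) (1 / 2)) (u : ℝ) : |stdInd t u| ≤ 1 := by
  obtain ⟨h0, h1⟩ := ht
  rcases le_or_gt u t with h | h
  · rw [stdInd_of_le h1 h, abs_one]
  · rw [stdInd_of_lt h, abs_div, abs_neg, abs_of_nonneg h0, abs_of_pos (by linarith)]
    exact div_le_one_of_le₀ (by linarith) (by linarith)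

/-- The uniform distribution on `[0, 1]`. -/
noncomputable abbrev unifMeasure : Measure ℝ := volume.restrict (Set.Icc (0 : ℝ) 1)

instance : IsProbabilityMeasure unifMeasure := ⟨by simp⟩

theorem integral_ite_le {t : ℝ} (ht : t ∈ Set.Icc (0 : ℝ) (1 / 2)) :
    ∫ u, (if u ≤ t then (1 : ℝ) else 0) ∂unifMeasure = t := by
  obtain ⟨h0, h1⟩ := ht
  have e : (fun u : ℝ => if u ≤ t then (1 : ℝ) else 0) = (Set.Iic t).indicator 1 := by
    funext u; simp [Set.indicator_apply]
  have e' : Set.Iic t ∩ Set.Icc (0 : ℝ) 1 = Set.Icc 0 t := by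
    ext u; simp only [Set.mem_inter_iff, Set.mem_Iic, Set.mem_Icc]
    constructor
    · rintro ⟨h, h', -⟩; exact ⟨h', h⟩
    · rintro ⟨h, h'⟩; exact ⟨h', h, by linarith⟩
  rw [e, integral_indicator_one measurableSet_Iic, measureReal_restrict_apply measurableSet_Iic, e',
    Real.volume_real_Icc_of_le h0, sub_zero]

theorem integrable_ite_le (t : ℝ) :
    Integrable (fun u : ℝ => if u ≤ t then (1 : ℝ) else 0) unifMeasure :=
  integrable_of_abs_le (b := 1) (measurable_ite_le t) fun u => by split_ifs <;> simp

theorem integral_stdInd {t : ℝ} (ht : t ∈ Set.Icc (0 : ℝ) (1 / 2)) :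
    ∫ u, stdInd t u ∂unifMeasure = 0 := by
  simp only [stdInd]
  rw [integral_div, integral_sub (integrable_ite_le t) (integrable_const t), integral_ite_le ht]
  simp

theorem integral_stdInd_sq {t : ℝ} (ht : t ∈ Set.Icc (0 : ℝ) (1 / 2)) :
    ∫ u, stdInd t u ^ 2 ∂unifMeasure = t / (1 - t) := by
  have h1 : (1 - t) ≠ 0 := by linarith [ht.2]
  -- An indicator equals its square, so the square is affine in it.
  have : ∀ u, stdInd t u ^ 2 =
      ((1 - 2 * t) * (if u ≤ t then 1 else 0) + t ^ 2) / (1 - t) ^ 2 := fun u => by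
    rw [stdInd, div_pow]; split_ifs <;> ring
  simp only [this]
  rw [integral_div, integral_add ((integrable_ite_le t).const_mul _) (integrable_const _),
    integral_const_mul, integral_ite_le ht]
  simp
  field_simp
  ring

/-- The running maxima of the normalised empirical process are orthogonal to its increments. -/
theorem integral_runMax_mul_increment (σ : ℝ) {t : ℕ → ℝ} (ht : ∀ k, t k ∈ Set.Icc (0 : ℝ) (1 / 2))
    (hmono : Monotone t) (n k : ℕ) (b : ℝ)
    (hbd : ∀ U : Fin n → ℝ, |runMax (fun j => σ * ∑ i, stdInd (t j) (U i)) k| ≤ b) :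
    ∫ U : Fin n → ℝ, runMax (fun j => σ * ∑ i, stdInd (t j) (U i)) k *
      (σ * ∑ i, stdInd (t (k + 1)) (U i) - σ * ∑ i, stdInd (t k) (U i))
      ∂(Measure.pi fun _ => unifMeasure) = 0 := by
  set R : (Fin n → ℝ) → ℝ := fun U => runMax (fun j => σ * ∑ i, stdInd (t j) (U i)) k with hR
  let d : ℝ → ℝ := fun u => stdInd (t (k + 1)) u - stdInd (t k) u
  have hRm : Measurable R := measurable_runMax (fun j => (Finset.measurable_sum _ fun i _ =>
    (measurable_stdInd (t j)).comp (measurable_pi_apply i)).const_mul σ) k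
  have hdm : Measurable d := (measurable_stdInd _).sub (measurable_stdInd _)
  have hd0 : ∫ u, d u ∂unifMeasure = 0 := by
    have hi : ∀ j, Integrable (stdInd (t j)) unifMeasure := fun j =>
      integrable_of_abs_le (measurable_stdInd _) (abs_stdInd_le (ht j))
    simp only [d]
    rw [integral_sub (hi _) (hi _), integral_stdInd (ht _), integral_stdInd (ht _), sub_zero]
  have hdb : ∀ u, |d u| ≤ 2 := fun u => by
    have h1 := abs_le.1 (abs_stdInd_le (ht (k + 1)) u)
    have h2 := abs_le.1 (abs_stdInd_le (ht k) u)
    rw [abs_le]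
    constructor <;> simp only [d] <;> linarith
  -- The martingale property in disguise. If `U i ≤ t k`, the increment is zero. Otherwise sample
  -- `i` is above all thresholds up to `t k`, and moving it to 1 leaves the running maximum
  -- unchanged. The frozen maximum is independent of sample `i`, and the increment is centred.
  have hfreeze : ∀ (U : Fin n → ℝ) (i : Fin n),
      R U * d (U i) = R (Function.update U i 1) * d (U i) := by
    intro U i
    rcases le_or_gt (U i) (t k) with h | h
    · have : d (U i) = 0 := by
        simp only [d]
        rw [stdInd_of_le (ht _).2 h, stdInd_of_le (ht _).2 (h.trans (hmono k.le_succ)), sub_self]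
      rw [this, mul_zero, mul_zero]
    · congr 1
      refine runMax_congr fun j hj => ?_
      congr 1
      refine Finset.sum_congr rfl fun l _ => ?_
      by_cases hl : l = i
      · subst hl
        rw [Function.update_self, stdInd_of_lt ((hmono hj).trans_lt h),
          stdInd_of_lt (by linarith [(ht j).2])]
      · rw [Function.update_of_ne hl]
  have hterm : ∀ i : Fin n,
      ∫ U : Fin n → ℝ, R U * d (U i) ∂(Measure.pi fun _ => unifMeasure) = 0 := by
    intro i
    rw [integral_congr_ae (Filter.Eventually.of_forall fun U => hfreeze U i)]
    rw [integral_pi_mul_eval unifMeasure i (G := fun U => R (Function.update U i 1))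
      (hRm.comp (measurable_update' (a := i) |>.comp (measurable_id.prodMk measurable_const)))
      (fun X a => by rw [Function.update_idem]) hdm, hd0, mul_zero]
  have hexp : ∀ U : Fin n → ℝ,
      R U * (σ * ∑ i, stdInd (t (k + 1)) (U i) - σ * ∑ i, stdInd (t k) (U i)) =
        σ * ∑ i, R U * d (U i) := fun U => by
    simp only [d]
    rw [← Finset.mul_sum, Finset.sum_sub_distrib]
    ring
  rw [integral_congr_ae (Filter.Eventually.of_forall hexp), integral_const_mul, integral_finsetSum, Finset.sum_eq_zero fun i _ => hterm i, mul_zero]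
  intro i _
  refine integrable_of_abs_le (b := b * 2) (hRm.mul (hdm.comp (measurable_pi_apply i))) fun U => ?_
  rw [abs_mul]
  exact mul_le_mul (hbd U) (hdb _) (abs_nonneg _) ((abs_nonneg _).trans (hbd U))

/-- Maximal inequality for the normalised empirical process, one-sided. -/
theorem integral_runMax_le {σ : ℝ} (hσ : |σ| = 1) {t : ℕ → ℝ}
    (ht : ∀ k, t k ∈ Set.Icc (0 : ℝ) (1 / 2)) (hmono : Monotone t) (n J : ℕ) :
    ∫ U : Fin n → ℝ, runMax (fun j => σ * ∑ i, stdInd (t j) (U i)) J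
      ∂(Measure.pi fun _ => unifMeasure) ≤ Real.sqrt (8 * (n * t J)) := by
  set P := Measure.pi fun _ : Fin n => unifMeasure
  let x : ℕ → (Fin n → ℝ) → ℝ := fun j U => σ * ∑ i, stdInd (t j) (U i)
  let M : ℕ → (Fin n → ℝ) → ℝ := fun k U => runMax (fun j => x j U) k
  have hxm : ∀ j, Measurable (x j) := fun j => (Finset.measurable_sum _ fun i _ =>
    (measurable_stdInd (t j)).comp (measurable_pi_apply i)).const_mul σ
  have hMm : ∀ k, Measurable (M k) := measurable_runMax hxm
  have hxb : ∀ j U, |x j U| ≤ n := fun j U => by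
    simp only [x]
    rw [abs_mul, hσ, one_mul]
    simpa using abs_sum_eval_le (abs_stdInd_le (ht j)) (Finset.univ : Finset (Fin n)) U
  have hMb : ∀ k U, |M k U| ≤ n := fun k U => by
    rw [abs_of_nonneg (runMax_nonneg _ _)]
    exact runMax_le (Nat.cast_nonneg n) (fun j => (le_abs_self _).trans (hxb j U)) k
  have hMi : Integrable (M J) P := integrable_of_abs_le (hMm J) (hMb J)
  have hM2i : Integrable (fun U => M J U ^ 2) P :=
    integrable_of_abs_le (b := (n : ℝ) ^ 2) ((hMm J).pow_const 2) fun U => by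
      rw [abs_pow]; exact pow_le_pow_left₀ (abs_nonneg _) (hMb J U) 2
  have hx2i : Integrable (fun U => x J U ^ 2) P :=
    integrable_of_abs_le (b := (n : ℝ) ^ 2) ((hxm J).pow_const 2) fun U => by
      rw [abs_pow]; exact pow_le_pow_left₀ (abs_nonneg _) (hxb J U) 2
  have hinci : ∀ k, Integrable (fun U => M k U * (x (k + 1) U - x k U)) P := fun k =>
    integrable_of_abs_le (b := n * (n + n)) ((hMm k).mul ((hxm _).sub (hxm _))) fun U => by
      rw [abs_mul]
      exact mul_le_mul (hMb k U) ((abs_sub _ _).trans (add_le_add (hxb _ U) (hxb _ U)))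
        (abs_nonneg _) (Nat.cast_nonneg n)
  have hsumi : Integrable (fun U => ∑ k ∈ Finset.range J, M k U * (x (k + 1) U - x k U)) P :=
    integrable_finsetSum _ fun k _ => hinci k
  have hsum0 : ∫ U, ∑ k ∈ Finset.range J, M k U * (x (k + 1) U - x k U) ∂P = 0 := by
    rw [integral_finsetSum _ fun k _ => hinci k]
    exact Finset.sum_eq_zero fun k _ =>
      integral_runMax_mul_increment σ ht hmono n k n (hMb k)
  have hx2 : ∫ U, x J U ^ 2 ∂P ≤ 2 * (n * t J) := by
    have hσ2 : σ ^ 2 = 1 := by rw [← sq_abs, hσ, one_pow]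
    have := (moments_sum_eval unifMeasure (measurable_stdInd (t J)) (abs_stdInd_le (ht J))
      (integral_stdInd (ht J)) (Finset.univ : Finset (Fin n))).2.1
    rw [integral_stdInd_sq (ht J), Finset.card_univ, Fintype.card_fin] at this
    simp only [x, mul_pow, hσ2, one_mul]
    rw [this]
    have h2 : t J / (1 - t J) ≤ 2 * t J := by
      obtain ⟨h0, h1⟩ := ht J
      rw [div_le_iff₀ (by linarith)]
      nlinarith
    calc (n : ℝ) * (t J / (1 - t J)) ≤ n * (2 * t J) := by gcongr
      _ = 2 * (n * t J) := by ring
  have hM2 : ∫ U, M J U ^ 2 ∂P ≤ 8 * (n * t J) := by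
    -- Twice the pathwise inequality, with 4xM ≤ 4x² + M² absorbing the cross term.
    have hpt : ∀ U, M J U ^ 2 ≤ 4 * x J U ^ 2 -
        4 * ∑ k ∈ Finset.range J, M k U * (x (k + 1) U - x k U) := fun U => by
      have := runMax_sq_le (fun j => x j U) J
      simp only [M]
      nlinarith [sq_nonneg (2 * x J U - runMax (fun j => x j U) J)]
    have := integral_mono hM2i ((hx2i.const_mul 4).sub (hsumi.const_mul 4)) hpt
    rw [integral_sub' (hx2i.const_mul 4) (hsumi.const_mul 4), integral_const_mul,
      integral_const_mul, hsum0] at this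
    linarith
  refine Real.le_sqrt_of_sq_le (le_trans ?_ hM2)
  set a := ∫ U, M J U ∂P with ha
  change a ^ 2 ≤ _
  -- Expanding (M - a)² ≥ 0 and integrating gives (E M)² ≤ E M².
  have hpt : ∀ U, 2 * a * M J U - a ^ 2 ≤ M J U ^ 2 := fun U => by
    nlinarith [sq_nonneg (M J U - a)]
  have := integral_mono ((hMi.const_mul (2 * a)).sub (integrable_const (a ^ 2))) hM2i hpt
  rw [integral_sub' (hMi.const_mul _) (integrable_const _), integral_const_mul, ← ha] at this
  simp only [integral_const, probReal_univ, one_smul] at this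
  linarith

/-! ### The lower bound for an arbitrary distribution. -/

theorem meanSeq_mem (μ : Measure (ℕ → Bool)) [IsProbabilityMeasure μ] (j : ℕ) :
    meanSeq μ j ∈ Set.Icc (0 : ℝ) 1 := by
  have hi : Integrable (fun x : ℕ → Bool => bitVal (x j)) μ :=
    integrable_of_abs_le (b := 1) (measurable_bitVal.comp (measurable_pi_apply j)) fun x => by
      rw [abs_of_nonneg (bitVal_mem _).1]; exact (bitVal_mem _).2
  refine ⟨integral_nonneg fun x => (bitVal_mem (x j)).1, ?_⟩
  have h := integral_mono hi (integrable_const 1) fun x => (bitVal_mem (x j)).2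
  simpa [meanSeq] using h

/-- The lower bound on the expected maximal deviation: the first coordinate alone. -/
theorem le_expMaxDev (ν : Measure (ℕ → Bool)) [IsProbabilityMeasure ν]
    (hq : meanSeq ν 0 ≤ 1 / 2) {n : ℕ} (hn : 1 ≤ n) :
    1 / 12 * min (meanSeq ν 0) (Real.sqrt (meanSeq ν 0 / n)) ≤ expMaxDev ν n := by
  set q := meanSeq ν 0 with hqdef
  obtain ⟨hq0, hq1⟩ := meanSeq_mem ν 0
  rw [← hqdef] at hq0 hq1
  have hn0 : (0 : ℝ) < n := by exact_mod_cast hn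
  let f : (ℕ → Bool) → ℝ := fun x => bitVal (x 0) - q
  have hbm : Measurable fun x : ℕ → Bool => bitVal (x 0) :=
    measurable_bitVal.comp (measurable_pi_apply 0)
  have hbi : Integrable (fun x : ℕ → Bool => bitVal (x 0)) ν :=
    integrable_of_abs_le (b := 1) hbm fun x => by
      rw [abs_of_nonneg (bitVal_mem _).1]; exact (bitVal_mem _).2
  have hfm : Measurable f := hbm.sub_const q
  have hfb : ∀ x, |f x| ≤ 1 := fun x => by
    have := bitVal_mem (x 0)
    rw [abs_le]
    constructor <;> simp only [f] <;> linarith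
  have hf0 : ∫ x, f x ∂ν = 0 := by
    simp only [f]
    rw [integral_sub hbi (integrable_const _), integral_const, probReal_univ, one_smul]
    exact sub_self _
  have hf2 : ∫ x, f x ^ 2 ∂ν = q * (1 - q) := by
    have : ∀ x, f x ^ 2 = (1 - 2 * q) * bitVal (x 0) + q ^ 2 := fun x => by
      simp only [f]
      cases x 0 <;> simp [bitVal]
      ring
    simp only [this]
    rw [integral_add (hbi.const_mul _) (integrable_const _), integral_const_mul, integral_const,
      probReal_univ, one_smul]
    change (1 - 2 * q) * q + q ^ 2 = _
    ring
  have hmain := min_le_integral_abs_sum_eval ν hfm hfb hf0 n (a := n * q) (by positivity)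
    (by rw [hf2]; nlinarith [mul_nonneg hn0.le hq0])
    (by rw [hf2]; nlinarith [mul_nonneg hn0.le (sq_nonneg q)])
  have hpt : ∀ X : Fin n → ℕ → Bool, |∑ i, f (X i)| ≤ n * maxDev ν X := fun X => by
    have h := le_ciSup (bddAbove_maxDev ν X) 0
    have e : empMean X 0 - meanSeq ν 0 = (∑ i, f (X i)) / n := by
      simp only [f, empMean, Finset.sum_sub_distrib, Finset.sum_const, Finset.card_univ,
        Fintype.card_fin, nsmul_eq_mul, ← hqdef]
      field_simp
    simp only [e, abs_div, Nat.abs_cast] at h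
    rw [div_le_iff₀ hn0] at h
    rw [mul_comm]
    exact h
  have hint := integral_mono (μ := Measure.pi fun _ : Fin n => ν)
    (integrable_of_abs_le (b := n) (Finset.measurable_sum Finset.univ fun i _ =>
      hfm.comp (measurable_pi_apply i)).abs fun X => by
        rw [abs_abs]; simpa using abs_sum_eval_le hfb (Finset.univ : Finset (Fin n)) X)
    ((integrable_maxDev ν n).const_mul (n : ℝ)) hpt
  rw [integral_const_mul] at hint
  have hscale : min (n * q) (Real.sqrt (n * q)) = n * min q (Real.sqrt (q / n)) := by
    rw [mul_min_of_nonneg _ _ hn0.le]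
    congr 1
    rw [show (n : ℝ) * q = n ^ 2 * (q / n) by field_simp, Real.sqrt_mul (by positivity),
      Real.sqrt_sq hn0.le]
  rw [hscale] at hmain
  have := hmain.trans hint
  change _ ≤ n * expMaxDev ν n at this
  refine le_of_mul_le_mul_left (a := (n : ℝ)) ?_ hn0
  linarith

/-! ### The upper bounds for the monotone coupling. -/

theorem measurable_thresholds (p : ℕ → ℝ) :
    Measurable fun (u : ℝ) (j : ℕ) => decide (u ≤ p j) := by
  refine measurable_pi_lambda _ fun j => measurable_to_bool ?_
  have : (fun u : ℝ => decide (u ≤ p j)) ⁻¹' {true} = Set.Iic (p j) := by ext; simp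
  rw [this]
  exact measurableSet_Iic

theorem bitVal_decide_le (u t : ℝ) : bitVal (decide (u ≤ t)) = if u ≤ t then 1 else 0 := by
  simp [bitVal]

theorem isProbabilityMeasure_monotoneCoupling (p : ℕ → ℝ) :
    IsProbabilityMeasure (monotoneCoupling p) :=
  Measure.isProbabilityMeasure_map (μ := unifMeasure) (measurable_thresholds p).aemeasurable

theorem meanSeq_monotoneCoupling {p : ℕ → ℝ} (hp : ∀ j, p j ∈ Set.Icc (0 : ℝ) (1 / 2)) :
    meanSeq (monotoneCoupling p) = p := by
  funext j
  have hm : Measurable fun x : ℕ → Bool => bitVal (x j) :=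
    measurable_bitVal.comp (measurable_pi_apply j)
  rw [meanSeq, monotoneCoupling, integral_map (measurable_thresholds p).aemeasurable
    hm.aestronglyMeasurable]
  simp only [bitVal_decide_le]
  exact integral_ite_le (hp j)

/-- A product of pushforwards is the pushforward of the product, so the samples may be generated
from independent uniforms, where the threshold martingale lives. -/
theorem expMaxDev_monotoneCoupling (p : ℕ → ℝ) (n : ℕ) :
    expMaxDev (monotoneCoupling p) n =
      ∫ U : Fin n → ℝ, maxDev (monotoneCoupling p) (fun i j => decide (U i ≤ p j))
        ∂(Measure.pi fun _ => unifMeasure) := by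
  have := isProbabilityMeasure_monotoneCoupling p
  have hmap : (Measure.pi fun _ : Fin n => unifMeasure).map
      (fun U i j => decide (U i ≤ p j)) = Measure.pi fun _ : Fin n => monotoneCoupling p :=
    Measure.pi_map_pi (μ := fun _ : Fin n => unifMeasure)
      (f := fun _ (u : ℝ) (j : ℕ) => decide (u ≤ p j))
      (hμ := fun _ => by
        change SigmaFinite (monotoneCoupling p)
        infer_instance)
      fun _ => (measurable_thresholds p).aemeasurable
  rw [expMaxDev, ← hmap, integral_map]
  · exact (measurable_pi_lambda _ fun i =>
      (measurable_thresholds p).comp (measurable_pi_apply i)).aemeasurable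
  · rw [hmap]
    exact (integrable_maxDev _ n).aestronglyMeasurable

theorem measurable_empMean_thresholds (p : ℕ → ℝ) (n j : ℕ) :
    Measurable fun U : Fin n → ℝ => empMean (fun i j => decide (U i ≤ p j)) j := by
  refine Measurable.div_const (Finset.measurable_sum _ fun i _ => ?_) _
  exact measurable_bitVal.comp ((measurable_pi_apply j).comp
    ((measurable_thresholds p).comp (measurable_pi_apply i)))

/-- The upper bound on the expected maximal deviation by a multiple of the mean. -/
theorem expMaxDev_monotoneCoupling_le_mean {p : ℕ → ℝ} (hp : ∀ j, p j ∈ Set.Icc (0 : ℝ) (1 / 2))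
    (hmono : Antitone p) {n : ℕ} (hn : 1 ≤ n) :
    expMaxDev (monotoneCoupling p) n ≤ 2 * p 0 := by
  have := isProbabilityMeasure_monotoneCoupling p
  have hn0 : (0 : ℝ) < n := by exact_mod_cast hn
  let ind : ℝ → ℝ := fun u => if u ≤ p 0 then 1 else 0
  have hi : ∀ i : Fin n, Integrable (fun U : Fin n → ℝ => ind (U i))
      (Measure.pi fun _ => unifMeasure) := fun i =>
    integrable_comp_eval (μ := fun _ : Fin n => unifMeasure) (i := i) (integrable_ite_le (p 0))
  have hpt : ∀ U : Fin n → ℝ, maxDev (monotoneCoupling p) (fun i j => decide (U i ≤ p j)) ≤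
      (∑ i, ind (U i)) / n + p 0 := by
    intro U
    refine ciSup_le fun j => ?_
    rw [meanSeq_monotoneCoupling hp]
    have h1 : empMean (fun i j => decide (U i ≤ p j)) j ≤ (∑ i, ind (U i)) / n := by
      refine div_le_div_of_nonneg_right (Finset.sum_le_sum fun i _ => ?_) hn0.le
      rw [bitVal_decide_le]
      simp only [ind]
      by_cases h : U i ≤ p j
      · rw [if_pos h, if_pos (h.trans (hmono (Nat.zero_le j)))]
      · rw [if_neg h]; split_ifs <;> norm_num
    have h2 : 0 ≤ empMean (fun i j => decide (U i ≤ p j)) j :=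
      div_nonneg (Finset.sum_nonneg fun i _ => (bitVal_mem _).1) hn0.le
    have h3 := hmono (Nat.zero_le j)
    have h4 := (hp j).1
    rw [abs_le]
    constructor <;> linarith
  have hint : Integrable (fun U : Fin n → ℝ => (∑ i, ind (U i)) / n + p 0)
      (Measure.pi fun _ => unifMeasure) :=
    ((integrable_finsetSum _ fun i _ => hi i).div_const _).add (integrable_const _)
  have hmean : ∫ U : Fin n → ℝ, ((∑ i, ind (U i)) / n + p 0)
      ∂(Measure.pi fun _ => unifMeasure) = 2 * p 0 := by
    have he : ∀ i : Fin n, ∫ U : Fin n → ℝ, ind (U i) ∂(Measure.pi fun _ => unifMeasure) = p 0 :=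
      fun i => (integral_comp_eval (μ := fun _ : Fin n => unifMeasure) (i := i)
        (measurable_ite_le (p 0)).aestronglyMeasurable).trans (integral_ite_le (hp 0))
    rw [integral_add ((integrable_finsetSum _ fun i _ => hi i).div_const _) (integrable_const _),
      integral_div, integral_finsetSum _ fun i _ => hi i]
    simp only [he, Finset.sum_const, Finset.card_univ, Fintype.card_fin, nsmul_eq_mul,
      integral_const, probReal_univ, one_smul]
    field_simp
    ring
  rw [expMaxDev_monotoneCoupling, ← hmean]
  exact integral_mono_of_nonneg (Filter.Eventually.of_forall fun U =>
    Real.iSup_nonneg fun j => abs_nonneg _) hint (Filter.Eventually.of_forall hpt)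

/-- The upper bound on the expected maximal deviation by a multiple of the standard deviation. -/
theorem expMaxDev_monotoneCoupling_le_sqrt {p : ℕ → ℝ} (hp : ∀ j, p j ∈ Set.Icc (0 : ℝ) (1 / 2))
    (hmono : Antitone p) {n : ℕ} (hn : 1 ≤ n) :
    expMaxDev (monotoneCoupling p) n ≤ 6 * Real.sqrt (p 0 / n) := by
  have := isProbabilityMeasure_monotoneCoupling p
  have hn0 : (0 : ℝ) < n := by exact_mod_cast hn
  set P := Measure.pi fun _ : Fin n => unifMeasure with hP
  let D : (Fin n → ℝ) → ℕ → ℝ := fun U j =>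
    |empMean (fun i j => decide (U i ≤ p j)) j - meanSeq (monotoneCoupling p) j|
  have hDm : ∀ j, Measurable fun U => D U j := fun j =>
    ((measurable_empMean_thresholds p n j).sub_const _).abs
  have hD0 : ∀ U j, 0 ≤ D U j := fun U j => abs_nonneg _
  have hD1 : ∀ U j, D U j ≤ 1 := fun U j => abs_empMean_sub_meanSeq_le _ _ j
  have hDbdd : ∀ U, BddAbove (Set.range (D U)) := fun U => bddAbove_maxDev _ _
  have hSm : ∀ J, Measurable fun U => partialSups (D U) J := by
    intro J
    induction J with
    | zero => simpa using hDm 0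
    | succ J ih => simpa only [partialSups_add_one] using ih.max (hDm (J + 1))
  have hS1 : ∀ U J, |partialSups (D U) J| ≤ 1 := fun U J => by
    rw [abs_of_nonneg ((hD0 U 0).trans (le_partialSups_of_le (D U) (Nat.zero_le J)))]
    exact partialSups_le _ _ _ fun j _ => hD1 U j
  -- Dominated convergence reduces the supremum over all coordinates to finitely many, with a bound
  -- that must not depend on `J`.
  have hlim : Filter.Tendsto (fun J => ∫ U, partialSups (D U) J ∂P) Filter.atTop
      (nhds (∫ U, ⨆ j, D U j ∂P)) := by
    refine tendsto_integral_of_dominated_convergence (fun _ => 1)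
      (fun J => (hSm J).aestronglyMeasurable) (integrable_const _)
      (fun J => Filter.Eventually.of_forall fun U => hS1 U J)
      (Filter.Eventually.of_forall fun U => ?_)
    rw [← ciSup_partialSups_eq (hDbdd U)]
    exact tendsto_atTop_ciSup (partialSups (D U)).monotone
      (bddAbove_range_partialSups.2 (hDbdd U))
  rw [expMaxDev_monotoneCoupling]
  refine le_of_tendsto' hlim fun J => ?_
  -- Reversing the order makes the thresholds increase and end at `p 0`.
  let t : ℕ → ℝ := fun k => p (J - k)
  have ht : ∀ k, t k ∈ Set.Icc (0 : ℝ) (1 / 2) := fun k => hp _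
  have htm : Monotone t := fun a b hab => hmono (Nat.sub_le_sub_left hab J)
  have htJ : t J = p 0 := by simp [t]
  let R : ℝ → (Fin n → ℝ) → ℝ := fun σ U => runMax (fun j => σ * ∑ i, stdInd (t j) (U i)) J
  have hRi : ∀ σ : ℝ, |σ| = 1 → Integrable (R σ) P := by
    intro σ hσ
    refine integrable_of_abs_le (b := n) (measurable_runMax (fun j =>
      (Finset.measurable_sum _ fun i _ =>
        (measurable_stdInd (t j)).comp (measurable_pi_apply i)).const_mul σ) J) fun U => ?_
    rw [abs_of_nonneg (runMax_nonneg _ _)]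
    refine runMax_le hn0.le (fun j => (le_abs_self _).trans ?_) J
    rw [abs_mul, hσ, one_mul]
    simpa using abs_sum_eval_le (abs_stdInd_le (ht j)) (Finset.univ : Finset (Fin n)) U
  -- Undoing the normalisation costs a factor 1 - p j ≤ 1; the two signs of σ bound the absolute
  -- value, both running maxima being nonnegative.
  have hpt : ∀ U, partialSups (D U) J ≤ (R 1 U + R (-1) U) / n := by
    intro U
    refine partialSups_le _ _ _ fun j hj => ?_
    have hjt : t (J - j) = p j := by simp only [t]; congr 1; omega
    have h1 := le_runMax (fun j => (1 : ℝ) * ∑ i, stdInd (t j) (U i)) (Nat.sub_le J j)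
    have h2 := le_runMax (fun j => (-1 : ℝ) * ∑ i, stdInd (t j) (U i)) (Nat.sub_le J j)
    have h3 := runMax_nonneg (fun j => (1 : ℝ) * ∑ i, stdInd (t j) (U i)) J
    have h4 := runMax_nonneg (fun j => (-1 : ℝ) * ∑ i, stdInd (t j) (U i)) J
    simp only [hjt] at h1 h2
    obtain ⟨hp0, hp1⟩ := hp j
    have hpos : 0 < 1 - p j := by linarith
    have e : empMean (fun i j => decide (U i ≤ p j)) j - meanSeq (monotoneCoupling p) j =
        (1 - p j) * (∑ i, stdInd (p j) (U i)) / n := by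
      rw [meanSeq_monotoneCoupling hp, empMean]
      simp only [bitVal_decide_le, stdInd]
      rw [← Finset.sum_div, Finset.sum_sub_distrib, Finset.sum_const, Finset.card_univ,
        Fintype.card_fin, nsmul_eq_mul]
      field_simp
    change |_| ≤ _
    rw [e, abs_div, Nat.abs_cast, abs_mul, abs_of_pos hpos]
    refine div_le_div_of_nonneg_right ?_ hn0.le
    calc (1 - p j) * |∑ i, stdInd (p j) (U i)| ≤ 1 * |∑ i, stdInd (p j) (U i)| := by
          gcongr; linarith
      _ ≤ R 1 U + R (-1) U := by
          rw [one_mul, abs_le]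
          constructor <;> simp only [R] <;> linarith
  have hone : |(1 : ℝ)| = 1 := abs_one
  have hneg : |(-1 : ℝ)| = 1 := by rw [abs_neg, abs_one]
  have hI := integral_mono (integrable_of_abs_le (P := P) (hSm J) fun U => hS1 U J)
    (((hRi 1 hone).fun_add (hRi (-1) hneg)).div_const (n : ℝ)) hpt
  rw [integral_div, integral_add (hRi 1 hone) (hRi (-1) hneg)] at hI
  have b1 := integral_runMax_le hone ht htm n J
  have b2 := integral_runMax_le hneg ht htm n J
  rw [htJ] at b1 b2
  refine hI.trans ?_
  rw [div_le_iff₀ hn0]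
  -- Here √8 ≤ 3; the two signs then give the constant 6.
  have hs : Real.sqrt (8 * (n * p 0)) ≤ 3 * (n * Real.sqrt (p 0 / n)) := by
    rw [Real.sqrt_le_left (by positivity), mul_pow, mul_pow,
      Real.sq_sqrt (div_nonneg (hp 0).1 hn0.le)]
    have : (n : ℝ) ^ 2 * (p 0 / n) = n * p 0 := by field_simp
    rw [this]
    nlinarith [mul_nonneg hn0.le (hp 0).1]
  calc _ ≤ Real.sqrt (8 * (n * p 0)) + Real.sqrt (8 * (n * p 0)) := add_le_add b1 b2
    _ ≤ 6 * Real.sqrt (p 0 / n) * n := by linarith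

theorem mainTheorem5 :
    ∃ c C : ℝ, 0 < c ∧ 0 < C ∧
      ∀ p : ℕ → ℝ, (∀ j, p j ∈ Set.Icc (0 : ℝ) (1 / 2)) → Antitone p →
        (∃ μ : Measure (ℕ → Bool), μ = monotoneCoupling p ∧ IsProbabilityMeasure μ ∧
          meanSeq μ = p ∧
          ∀ n : ℕ, 1 ≤ n →
            c * min (p 0) (Real.sqrt (p 0 / n)) ≤ expMaxDev μ n ∧
            expMaxDev μ n ≤ C * min (p 0) (Real.sqrt (p 0 / n))) ∧
        (∀ ν : Measure (ℕ → Bool), IsProbabilityMeasure ν → meanSeq ν = p →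
          ∀ n : ℕ, 1 ≤ n → c * min (p 0) (Real.sqrt (p 0 / n)) ≤ expMaxDev ν n) := by
  refine ⟨1 / 12, 6, by norm_num, by norm_num, fun p hp hmono => ?_⟩
  have hlow : ∀ ν : Measure (ℕ → Bool), IsProbabilityMeasure ν → meanSeq ν = p →
      ∀ n : ℕ, 1 ≤ n → 1 / 12 * min (p 0) (Real.sqrt (p 0 / n)) ≤ expMaxDev ν n := by
    rintro ν hν rfl n hn
    exact le_expMaxDev ν (hp 0).2 hn
  have hμ := isProbabilityMeasure_monotoneCoupling p
  have hm := meanSeq_monotoneCoupling hp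
  refine ⟨⟨_, rfl, hμ, hm, fun n hn => ⟨hlow _ hμ hm n hn, ?_⟩⟩, hlow⟩
  rw [mul_min_of_nonneg _ _ (by norm_num)]
  refine le_min ?_ (expMaxDev_monotoneCoupling_le_sqrt hp hmono hn)
  linarith [expMaxDev_monotoneCoupling_le_mean hp hmono hn, (hp 0).1]
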